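/- Let $-\infty<a<b<\infty$ and let $p,Q$ be real-valued functions on $(a,b)$ with $p\neq 0$ a.e. and $1/p,\ Q/p,\ Q^2/p\in L_1(a,b)$. Put $$D^{[0]}y=y,\qquad D^{[1]}y=py'-Qy,\qquad D^{[2]}y=(D^{[1]}y)'+\frac{Q}{p}D^{[1]}y+\frac{Q^2}{p}y .$$ On the Hilbert space $L_2=L_2((a,b),\mathbb{C})$ let $L_{\max}y=-D^{[2]}y$ with domain $$\operatorname{Dom}(L_{\max})=\{y\in L_2 : y,\ D^{[1]}y\in AC([a,b],\mathbb{C}),\ D^{[2]}y\in L_2\},$$ let $L_{\min}$ be the restriction of $L_{\max}$ to those $y\in\operatorname{Dom}(L_{\max})$ with $D^{[k]}y(a)=D^{[k]}y(b)=0$ for $k=0,1$, and for $y\in\operatorname{Dom}(L_{\max})$ put $$\Gamma_1y=\bigl(D^{[1]}y(a),\,-D^{[1]}y(b)\bigr)\in\mathbb{C}^2,\qquad \Gamma_2y=\bigl(y(a),\,y(b)\bigr)\in\mathbb{C}^2 .$$ For a bounded linear operator $K$ on $\mathbb{C}^2$ let $L_K$ be the restriction of $L_{\max}$ to those $y\in\operatorname{Dom}(L_{\max})$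 that satisfy $$(K-I)\Gamma_1y+i(K+I)\Gamma_2y=0 .$$ Theorem. For every unitary operator $K$ on $\mathbb{C}^2$, the operator $L_K$ is a self-adjoint extension of $L_{\min}$. Conversely, for every self-adjoint extension $\widetilde L$ of $L_{\min}$ in $L_2$ there is a unitary operator $K$ on $\mathbb{C}^2$ such that $\widetilde L=L_K$. The correspondence $K\mapsto L_K$ between the unitary operators on $\mathbb{C}^2$ and the self-adjoint extensions of $L_{\min}$ is bijective. -/

import Mathlib

open MeasureTheory Set Filter

namespace SturmLiouville

noncomputable section

/-- The Hilbert space `L₂((a, b), ℂ)`. -/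
abbrev L2 (a b : ℝ) : Type := Lp ℂ 2 (volume.restrict (Ioo a b))

/-- `p u' - Q u`, defined wherever `u` is differentiable. -/
def quasiDeriv₁ (p Q : ℝ → ℝ) (u : ℝ → ℂ) (t : ℝ) : ℂ :=
  (p t : ℂ) * deriv u t - (Q t : ℂ) * u t

/-- `v' + (Q / p) v + (Q² / p) u`, where `v` stands for the first quasi-derivative of `u`. -/
def quasiDeriv₂ (p Q : ℝ → ℝ) (u v : ℝ → ℂ) (t : ℝ) : ℂ :=
  deriv v t + ((Q t / p t : ℝ) : ℂ) * v t + ((Q t ^ 2 / p t : ℝ) : ℂ) * u t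

/-- The class `y ∈ L₂` has the absolutely continuous representative `u = D⁰y`, its first
quasi-derivative `p u' - Q u` has the absolutely continuous representative `v = D¹y`, and the
second quasi-derivative is square-integrable. -/
structure IsQuasiRep {a b : ℝ} (p Q : ℝ → ℝ) (y : L2 a b) (u v : ℝ → ℂ) : Prop where
  ac₀ : AbsolutelyContinuousOnInterval u a b
  ac₁ : AbsolutelyContinuousOnInterval v a b
  ae₀ : (y : ℝ → ℂ) =ᵐ[volume.restrict (Ioo a b)] u
  ae₁ : v =ᵐ[volume.restrict (Ioo a b)] quasiDeriv₁ p Q u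
  memLp₂ : MemLp (quasiDeriv₂ p Q u v) 2 (volume.restrict (Ioo a b))

theorem ae_differentiableAt_of_ac {a b : ℝ} {u : ℝ → ℂ}
    (hu : AbsolutelyContinuousOnInterval u a b) :
    ∀ᵐ t ∂volume.restrict (Ioo a b), DifferentiableAt ℝ u t := by
  rw [ae_restrict_iff' measurableSet_Ioo]
  filter_upwards [hu.boundedVariationOn.ae_differentiableAt_of_mem_uIcc] with t ht hmem
  exact ht (Ioo_subset_Icc_self.trans Icc_subset_uIcc hmem)

theorem eqOn_of_ac {a b : ℝ} {u v : ℝ → ℂ}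
    (hu : AbsolutelyContinuousOnInterval u a b) (hv : AbsolutelyContinuousOnInterval v a b)
    (h : u =ᵐ[volume.restrict (Ioo a b)] v) : a < b → EqOn u v (Icc a b) := by
  intro hab
  have hu' := hu.continuousOn
  have hv' := hv.continuousOn
  rw [uIcc_of_le hab.le] at hu' hv'
  refine Measure.eqOn_Icc_of_ae_eq (μ := volume) hab.ne ?_ hu' hv'
  rwa [← restrict_Ioo_eq_restrict_Icc]

theorem deriv_ae_eq {a b : ℝ} {u v : ℝ → ℂ} (h : EqOn u v (Icc a b)) :
    deriv u =ᵐ[volume.restrict (Ioo a b)] deriv v := by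
  rw [EventuallyEq, ae_restrict_iff' measurableSet_Ioo]
  refine Eventually.of_forall fun t ht => ?_
  refine EventuallyEq.deriv_eq ?_
  filter_upwards [isOpen_Ioo.mem_nhds ht] with s hs
  exact h (Ioo_subset_Icc_self hs)

namespace IsQuasiRep

variable {a b : ℝ} {p Q : ℝ → ℝ} {y z : L2 a b} {u v u' v' : ℝ → ℂ}

theorem eqOn₀ (hab : a < b) (h : IsQuasiRep p Q y u v) (h' : IsQuasiRep p Q y u' v') :
    EqOn u u' (Icc a b) :=
  eqOn_of_ac h.ac₀ h'.ac₀ (h.ae₀.symm.trans h'.ae₀) hab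

theorem eqOn₁ (hab : a < b) (h : IsQuasiRep p Q y u v) (h' : IsQuasiRep p Q y u' v') :
    EqOn v v' (Icc a b) := by
  refine eqOn_of_ac h.ac₁ h'.ac₁ ?_ hab
  filter_upwards [h.ae₁, h'.ae₁, deriv_ae_eq (h.eqOn₀ hab h'), h.ae₀, h'.ae₀]
    with t h1 h2 h3 h4 h5
  rw [h1, h2, quasiDeriv₁, quasiDeriv₁, h3, ← h4, ← h5]

theorem quasiDeriv₂_ae_eq (h : IsQuasiRep p Q y u v)
    (h' : IsQuasiRep p Q y u' v') :
    quasiDeriv₂ p Q u v =ᵐ[volume.restrict (Ioo a b)] quasiDeriv₂ p Q u' v' := by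
  rcases lt_or_ge a b with hab | hab
  · have hm : ∀ᵐ t ∂volume.restrict (Ioo a b), t ∈ Ioo a b := ae_restrict_mem measurableSet_Ioo
    filter_upwards [deriv_ae_eq (h.eqOn₁ hab h'), hm] with t h1 ht
    have ht' := Ioo_subset_Icc_self ht
    rw [quasiDeriv₂, quasiDeriv₂, h1, h.eqOn₁ hab h' ht', h.eqOn₀ hab h' ht']
  · simp [Ioo_eq_empty_of_le hab, EventuallyEq]

theorem quasiDeriv₂_add (h : IsQuasiRep p Q y u v) (h' : IsQuasiRep p Q z u' v') :
    quasiDeriv₂ p Q (u + u') (v + v') =ᵐ[volume.restrict (Ioo a b)]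
      quasiDeriv₂ p Q u v + quasiDeriv₂ p Q u' v' := by
  filter_upwards [ae_differentiableAt_of_ac h.ac₁, ae_differentiableAt_of_ac h'.ac₁] with t h1 h2
  simp only [quasiDeriv₂, Pi.add_apply, deriv_add h1 h2]
  ring

theorem quasiDeriv₂_smul (c : ℂ) (u v : ℝ → ℂ) :
    quasiDeriv₂ p Q (c • u) (c • v) = c • quasiDeriv₂ p Q u v := by
  funext t
  simp only [quasiDeriv₂, Pi.smul_apply, smul_eq_mul, deriv_const_smul_field]
  ring

theorem add (h : IsQuasiRep p Q y u v) (h' : IsQuasiRep p Q z u' v') :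
    IsQuasiRep p Q (y + z) (u + u') (v + v') where
  ac₀ := h.ac₀.add h'.ac₀
  ac₁ := h.ac₁.add h'.ac₁
  ae₀ := (Lp.coeFn_add y z).trans (h.ae₀.add h'.ae₀)
  ae₁ := by
    filter_upwards [h.ae₁, h'.ae₁, ae_differentiableAt_of_ac h.ac₀,
      ae_differentiableAt_of_ac h'.ac₀] with t h1 h2 h3 h4
    simp only [Pi.add_apply, h1, h2, quasiDeriv₁, deriv_add h3 h4]
    ring
  memLp₂ := (memLp_congr_ae (h.quasiDeriv₂_add h')).2 (h.memLp₂.add h'.memLp₂)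

theorem smul (c : ℂ) (h : IsQuasiRep p Q y u v) : IsQuasiRep p Q (c • y) (c • u) (c • v) where
  ac₀ := h.ac₀.const_smul c
  ac₁ := h.ac₁.const_smul c
  ae₀ := (Lp.coeFn_smul c y).trans (h.ae₀.const_smul c)
  ae₁ := by
    filter_upwards [h.ae₁] with t h1
    simp only [Pi.smul_apply, smul_eq_mul, h1, quasiDeriv₁, deriv_const_smul_field]
    ring
  memLp₂ := by
    rw [quasiDeriv₂_smul]
    exact h.memLp₂.const_smul c

theorem zero : IsQuasiRep p Q (0 : L2 a b) 0 0 where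
  ac₀ := by
    have h : ContDiffOn ℝ 1 (0 : ℝ → ℂ) (uIcc a b) := contDiffOn_const
    exact h.absolutelyContinuousOnInterval
  ac₁ := by
    have h : ContDiffOn ℝ 1 (0 : ℝ → ℂ) (uIcc a b) := contDiffOn_const
    exact h.absolutelyContinuousOnInterval
  ae₀ := Lp.coeFn_zero ℂ 2 _
  ae₁ := by
    refine Eventually.of_forall fun t => ?_
    simp [quasiDeriv₁]
  memLp₂ := by
    have h : quasiDeriv₂ p Q 0 0 = 0 := by
      funext t
      simp [quasiDeriv₂]
    rw [h]
    exact MemLp.zero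

end IsQuasiRep

section operators

variable {a b : ℝ} (p Q : ℝ → ℝ)

/-- `Dom(L_max)`: all `y ∈ L₂` with `y, D¹y` absolutely continuous on `[a, b]` and `D²y ∈ L₂`. -/
def maxDomain (a b : ℝ) (p Q : ℝ → ℝ) : Submodule ℂ (L2 a b) where
  carrier := {y | ∃ u v : ℝ → ℂ, IsQuasiRep p Q y u v}
  zero_mem' := ⟨0, 0, IsQuasiRep.zero⟩
  add_mem' := by
    rintro y z ⟨u, v, h⟩ ⟨u', v', h'⟩
    exact ⟨_, _, h.add h'⟩
  smul_mem' := by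
    rintro c y ⟨u, v, h⟩
    exact ⟨_, _, h.smul c⟩

variable {p Q}

/-- The absolutely continuous representative `D⁰y` of `y`. -/
def D₀ (y : maxDomain a b p Q) : ℝ → ℂ := y.2.choose

/-- The absolutely continuous representative `D¹y` of `p y' - Q y`. -/
def D₁ (y : maxDomain a b p Q) : ℝ → ℂ := y.2.choose_spec.choose

theorem isQuasiRep_D (y : maxDomain a b p Q) : IsQuasiRep p Q (y : L2 a b) (D₀ y) (D₁ y) :=
  y.2.choose_spec.choose_spec

/-- The second quasi-derivative `D²y`, as an element of `L₂`. -/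
def D₂ (y : maxDomain a b p Q) : L2 a b := (isQuasiRep_D y).memLp₂.toLp _

theorem D₂_add (y z : maxDomain a b p Q) : D₂ (y + z) = D₂ y + D₂ z := by
  have h := (isQuasiRep_D y).add (isQuasiRep_D z)
  rw [D₂, D₂, D₂, ← MemLp.toLp_add, MemLp.toLp_eq_toLp_iff]
  exact ((isQuasiRep_D (y + z)).quasiDeriv₂_ae_eq h).trans
    ((isQuasiRep_D y).quasiDeriv₂_add (isQuasiRep_D z))

theorem D₂_smul (c : ℂ) (y : maxDomain a b p Q) : D₂ (c • y) = c • D₂ y := by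
  have h := (isQuasiRep_D y).smul c
  rw [D₂, D₂, ← MemLp.toLp_const_smul, MemLp.toLp_eq_toLp_iff]
  refine ((isQuasiRep_D (c • y)).quasiDeriv₂_ae_eq h).trans ?_
  rw [IsQuasiRep.quasiDeriv₂_smul]

/-- The value `(D⁰y)(c)` at a point `c ∈ [a, b]`. -/
def eval₀ (hab : a < b) (c : Icc a b) : maxDomain a b p Q →ₗ[ℂ] ℂ where
  toFun y := D₀ y c
  map_add' y z :=
    (isQuasiRep_D (y + z)).eqOn₀ hab ((isQuasiRep_D y).add (isQuasiRep_D z)) c.2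
  map_smul' k y := (isQuasiRep_D (k • y)).eqOn₀ hab ((isQuasiRep_D y).smul k) c.2

/-- The value `(D¹y)(c)` at a point `c ∈ [a, b]`. -/
def eval₁ (hab : a < b) (c : Icc a b) : maxDomain a b p Q →ₗ[ℂ] ℂ where
  toFun y := D₁ y c
  map_add' y z :=
    (isQuasiRep_D (y + z)).eqOn₁ hab ((isQuasiRep_D y).add (isQuasiRep_D z)) c.2
  map_smul' k y := (isQuasiRep_D (k • y)).eqOn₁ hab ((isQuasiRep_D y).smul k) c.2

/-- The maximal operator `y ↦ l[y] = -D²y`. -/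
def Lmax (a b : ℝ) (p Q : ℝ → ℝ) : L2 a b →ₗ.[ℂ] L2 a b where
  domain := maxDomain a b p Q
  toFun :=
    { toFun := fun y => -D₂ y
      map_add' := fun y z => by rw [D₂_add, neg_add]
      map_smul' := fun c y => by rw [D₂_smul, smul_neg, RingHom.id_apply] }

/-- The space `ℂ²` with its standard inner product. -/
abbrev C2 : Type := EuclideanSpace ℂ (Fin 2)

/-- The linear map `Dom(L_max) → ℂ²` with coordinates `φ₀` and `φ₁`. -/
def pair (φ₀ φ₁ : maxDomain a b p Q →ₗ[ℂ] ℂ) : maxDomain a b p Q →ₗ[ℂ] C2 where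
  toFun y := !₂[φ₀ y, φ₁ y]
  map_add' y z := by
    ext i
    fin_cases i <;> simp
  map_smul' c y := by
    ext i
    fin_cases i <;> simp

/-- `Γ₁ y = (D¹y(a), -D¹y(b))`. -/
def Γ₁ (hab : a < b) : maxDomain a b p Q →ₗ[ℂ] C2 :=
  pair (eval₁ hab ⟨a, left_mem_Icc.2 hab.le⟩) (-eval₁ hab ⟨b, right_mem_Icc.2 hab.le⟩)

/-- `Γ₂ y = (y(a), y(b))`. -/
def Γ₂ (hab : a < b) : maxDomain a b p Q →ₗ[ℂ] C2 :=
  pair (eval₀ hab ⟨a, left_mem_Icc.2 hab.le⟩) (eval₀ hab ⟨b, right_mem_Icc.2 hab.le⟩)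

/-- `Dom(L_min)`: all `y ∈ Dom(L_max)` with `D⁰y` and `D¹y` vanishing at `a` and at `b`. -/
def minDomain (hab : a < b) (p Q : ℝ → ℝ) : Submodule ℂ (maxDomain a b p Q) where
  carrier := {y | eval₀ hab ⟨a, left_mem_Icc.2 hab.le⟩ y = 0 ∧
    eval₁ hab ⟨a, left_mem_Icc.2 hab.le⟩ y = 0 ∧
    eval₀ hab ⟨b, right_mem_Icc.2 hab.le⟩ y = 0 ∧
    eval₁ hab ⟨b, right_mem_Icc.2 hab.le⟩ y = 0}
  zero_mem' := by simp
  add_mem' := by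
    rintro y z ⟨h1, h2, h3, h4⟩ ⟨k1, k2, k3, k4⟩
    simp [h1, h2, h3, h4, k1, k2, k3, k4]
  smul_mem' := by
    rintro c y ⟨h1, h2, h3, h4⟩
    simp [h1, h2, h3, h4]

/-- The minimal operator, the restriction of `L_max` to `Dom(L_min)`. -/
def Lmin (hab : a < b) (p Q : ℝ → ℝ) : L2 a b →ₗ.[ℂ] L2 a b :=
  (Lmax a b p Q).domRestrict ((minDomain hab p Q).map (maxDomain a b p Q).subtype)

/-- All `y ∈ Dom(L_max)` with `(K - I) Γ₁ y + i (K + I) Γ₂ y = 0`. -/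
def boundaryDomain (hab : a < b) (p Q : ℝ → ℝ) (K : C2 →L[ℂ] C2) :
    Submodule ℂ (maxDomain a b p Q) where
  carrier := {y | (K - 1) (Γ₁ hab y) + Complex.I • (K + 1) (Γ₂ hab y) = 0}
  zero_mem' := by simp
  add_mem' := by
    intro y z hy hz
    have h := congrArg₂ (· + ·) hy hz
    simp only [add_zero] at h
    rw [mem_ofPred_eq, map_add, map_add, map_add, map_add, smul_add, ← h]
    abel
  smul_mem' := by
    intro c y hy
    rw [mem_ofPred_eq] at hy ⊢
    rw [map_smul, map_smul, map_smul, map_smul, smul_comm Complex.I c, ← smul_add, hy, smul_zero]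

/-- The operator `L_K`, the restriction of `L_max` by the boundary condition
`(K - I) Γ₁ y + i (K + I) Γ₂ y = 0`. -/
def LK (hab : a < b) (p Q : ℝ → ℝ) (K : C2 →L[ℂ] C2) : L2 a b →ₗ.[ℂ] L2 a b :=
  (Lmax a b p Q).domRestrict ((boundaryDomain hab p Q K).map (maxDomain a b p Q).subtype)

end operators

end

end SturmLiouville

/-!
Write `ω(x, y) = ⟪x₁, y₂⟫ - ⟪x₂, y₁⟫` for `x, y ∈ ℂ² × ℂ²`. The triple `(ℂ², Γ₁, Γ₂)` is a boundary
triple for `L_max`: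

* `lagrange_identity`: `⟪L_max y, z⟫ - ⟪y, L_max z⟫ = ω(Γ y, Γ z)` for `Γ = (Γ₁, Γ₂)`;
* `exists_maxDomain_of_boundary`: `Γ` maps `Dom(L_max)` onto `ℂ² × ℂ²`;
* `exists_maxDomain_of_inner_minDomain`: `z` and `w` with `⟪w, y⟫ = ⟪z, L_min y⟫` for all `y` in
  `Dom(L_min)` satisfy `z ∈ Dom(L_max)` and `L_max z = w`. With `z = 0` this shows that `L_min` is
  densely defined, and then that `L_min* ≤ L_max`.

All three rest on the regularity of the quasi-differential expression: `(y, D¹y)` solves a first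
order linear system with integrable coefficients, so the initial value problem is solvable from
either endpoint (`exists_linear_integral_equation`, by a contraction in a weighted supremum norm),
and the fundamental theorem of calculus for absolutely continuous functions gives the Lagrange
identity.

The self-adjoint extensions of `L_min` are therefore the restrictions of `L_max` to subspaces `D`
such that `Γ(D)` is its own annihilator for `ω` (`isSelfAdjoint_restrictMax`,
`exists_eq_restrictMax`). The boundary condition of `L_K` reads `K (x₁ + i x₂) = x₁ - i x₂`, and in
the coordinates `x₁ ± i x₂` the form `ω` is a multiple of the difference of two inner products; the
self-annihilating subspaces of `ℂ² × ℂ²` are thus the graphs of unitary operators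
(`self_dual_of_mem_unitary`, `exists_unitary_of_self_dual`), and `K` is determined by its graph.
-/

namespace SturmLiouville

/-! ### Absolutely continuous functions with values in a normed space -/

section AbsolutelyContinuous

variable {E F : Type*} [NormedAddCommGroup E] [NormedAddCommGroup F] {a b : ℝ}

theorem ac_of_dist_le {X Y : Type*} [PseudoMetricSpace X] [PseudoMetricSpace Y]
    {f : ℝ → X} {g : ℝ → Y} {C : ℝ} (hf : AbsolutelyContinuousOnInterval f a b)
    (h : ∀ x ∈ uIcc a b, ∀ y ∈ uIcc a b, dist (g x) (g y) ≤ C * dist (f x) (f y)) :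
    AbsolutelyContinuousOnInterval g a b := by
  unfold AbsolutelyContinuousOnInterval at hf ⊢
  have hf' := hf.const_mul C
  rw [mul_zero] at hf'
  refine squeeze_zero' (Eventually.of_forall fun E => Finset.sum_nonneg fun _ _ => dist_nonneg)
    ?_ hf'
  rw [eventually_inf_principal]
  refine Eventually.of_forall fun E hE => ?_
  rw [Finset.mul_sum]
  exact Finset.sum_le_sum fun i hi => h _ (hE.1 i hi).1 _ (hE.1 i hi).2

theorem ac_comp_of_lipschitzWith {X Y : Type*} [PseudoMetricSpace X] [PseudoMetricSpace Y]
    {f : ℝ → X} {g : X → Y} {C : NNReal} (hg : LipschitzWith C g)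
    (hf : AbsolutelyContinuousOnInterval f a b) :
    AbsolutelyContinuousOnInterval (fun t => g (f t)) a b :=
  ac_of_dist_le hf fun x _ y _ => hg.dist_le_mul (f x) (f y)

theorem ac_exp {f : ℝ → ℝ} (hf : AbsolutelyContinuousOnInterval f a b) :
    AbsolutelyContinuousOnInterval (fun t => Real.exp (f t)) a b := by
  obtain ⟨C, hC⟩ := hf.exists_bound
  obtain ⟨K, hK⟩ := (Real.contDiff_exp (n := 1)).contDiffOn.exists_lipschitzOnWith
    (by decide) (convex_Icc (-C) C) isCompact_Icc
  refine ac_of_dist_le hf fun x hx y hy => hK.dist_le_mul _ ?_ _ ?_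
  · exact abs_le.1 (hC x hx)
  · exact abs_le.1 (hC y hy)

variable [NormedSpace ℝ E]

theorem ac_primitive {f : ℝ → E} (c : ℝ) (hf : Integrable f) :
    AbsolutelyContinuousOnInterval (fun t => ∫ s in c..t, f s) a b := by
  have h := (hf.norm.intervalIntegrable (a := a) (b := b)
    ).absolutelyContinuousOnInterval_intervalIntegral (c := a) left_mem_uIcc
  refine ac_of_dist_le (C := 1) h fun x _ y _ => ?_
  rw [one_mul, dist_eq_norm, Real.dist_eq,
    intervalIntegral.integral_interval_sub_left hf.intervalIntegrable hf.intervalIntegrable,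
    intervalIntegral.integral_interval_sub_left hf.norm.intervalIntegrable
      hf.norm.intervalIntegrable]
  exact intervalIntegral.norm_integral_le_abs_integral_norm

theorem ae_hasDerivAt_primitive [CompleteSpace E] {f : ℝ → E} (c : ℝ) (hf : Integrable f) :
    ∀ᵐ t, HasDerivAt (fun t => ∫ s in c..t, f s) (f t) t := by
  filter_upwards [LocallyIntegrable.ae_hasDerivAt_integral hf.locallyIntegrable] with t ht using ht c

/-- The fundamental theorem of calculus for an absolutely continuous function whose derivative is
known almost everywhere. -/
theorem integral_eq_sub_of_ac [CompleteSpace E] {f g : ℝ → E} (hab : a < b)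
    (hf : AbsolutelyContinuousOnInterval f a b) (hg : IntegrableOn g (Ioo a b))
    (h : ∀ᵐ t ∂volume.restrict (Ioo a b), HasDerivAt f (g t) t) :
    ∫ t in Ioo a b, g t = f b - f a := by
  set G := (Ioo a b).indicator g with hG
  have hGi : Integrable G := (integrable_indicator_iff measurableSet_Ioo).2 hg
  have hsub := hf.sub (ac_primitive a hGi)
  have h0 : ∀ᵐ t, t ∈ uIcc a b → HasDerivAt (f - fun t => ∫ s in a..t, G s) 0 t := by
    rw [ae_restrict_iff' measurableSet_Ioo] at h
    filter_upwards [h, ae_hasDerivAt_primitive a hGi, measure_eq_zero_iff_ae_notMem.1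
      (measure_singleton (μ := volume) a), measure_eq_zero_iff_ae_notMem.1
      (measure_singleton (μ := volume) b)] with t h1 h2 ha hb ht
    rw [uIcc_of_le hab.le] at ht
    have ht' : t ∈ Ioo a b := ⟨lt_of_le_of_ne ht.1 (Ne.symm ha), lt_of_le_of_ne ht.2 hb⟩
    have h3 := (h1 ht').sub h2
    rwa [hG, indicator_of_mem ht', sub_self] at h3
  obtain ⟨C, hC⟩ := hsub.const_of_ae_hasDerivAt_zero h0
  have ha := hC a left_mem_uIcc
  have hb := hC b right_mem_uIcc
  simp only [Pi.sub_apply, intervalIntegral.integral_same, sub_zero] at ha hb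
  rw [intervalIntegral.integral_of_le hab.le, integral_Ioc_eq_integral_Ioo, hG,
    setIntegral_indicator measurableSet_Ioo, inter_self, ← ha] at hb
  rw [← hb]
  abel

end AbsolutelyContinuous

/-! ### Linear differential equations with integrable coefficients -/

section Caratheodory

variable {E : Type*} [NormedAddCommGroup E] [NormedSpace ℝ E]

/-- With `m t = ∫ s in c..t, k s`, the function `k * exp (2 |m|)` has the primitive
`± exp (2 |m|) / 2`, the sign of `± m` being constant on either side of `c`. -/
theorem abs_integral_mul_exp_le {k : ℝ → ℝ} (hk : Integrable k) (hk0 : ∀ t, 0 ≤ k t) (c t : ℝ) :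
    |∫ s in c..t, k s * Real.exp (2 * |∫ r in c..s, k r|)| ≤
      Real.exp (2 * |∫ r in c..t, k r|) / 2 := by
  set m : ℝ → ℝ := fun t => ∫ r in c..t, k r with hm
  have key : ∀ σ : ℝ, σ * σ = 1 → ∫ s in c..t, k s * Real.exp (2 * (σ * m s)) =
      σ * (Real.exp (2 * (σ * m t)) - 1) / 2 := by
    intro σ hσ
    have hac : AbsolutelyContinuousOnInterval
        (fun s => (σ / 2) • Real.exp ((2 * σ) • m s)) c t :=
      (ac_exp ((ac_primitive c hk).const_smul (2 * σ))).const_smul (σ / 2)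
    have h := hac.integral_deriv_eq_sub
    have hcongr : ∫ s in c..t, deriv (fun s => (σ / 2) • Real.exp ((2 * σ) • m s)) s =
        ∫ s in c..t, k s * Real.exp (2 * (σ * m s)) := by
      refine intervalIntegral.integral_congr_ae ?_
      filter_upwards [ae_hasDerivAt_primitive c hk] with s hs _
      have h1 := (((hs.const_smul (2 * σ)).exp).const_smul (σ / 2)).deriv
      refine h1.trans ?_
      simp only [smul_eq_mul, Pi.smul_apply]
      rw [show 2 * σ * m s = 2 * (σ * m s) by ring]
      linear_combination (k s * Real.exp (2 * (σ * m s))) * hσ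
    rw [hcongr] at h
    rw [h]
    simp only [hm, intervalIntegral.integral_same, smul_eq_mul, mul_zero, Real.exp_zero]
    ring_nf
  rcases le_total c t with hct | htc
  · have h1 : ∀ s ∈ uIcc c t, |m s| = 1 * m s := fun s hs => by
      rw [uIcc_of_le hct] at hs
      rw [one_mul, abs_of_nonneg (intervalIntegral.integral_nonneg hs.1 fun r _ => hk0 r)]
    rw [intervalIntegral.integral_congr (g := fun s => k s * Real.exp (2 * (1 * m s)))
      fun s hs => congrArg (fun r => k s * Real.exp (2 * r)) (h1 s hs), key 1 (by norm_num),
      h1 t right_mem_uIcc]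
    have : 1 ≤ Real.exp (2 * (1 * m t)) := by
      rw [← h1 t right_mem_uIcc]
      exact Real.one_le_exp (by positivity)
    rw [abs_of_nonneg (by linarith)]
    linarith
  · have h1 : ∀ s ∈ uIcc c t, |m s| = -1 * m s := fun s hs => by
      rw [uIcc_of_ge htc] at hs
      rw [neg_one_mul, abs_of_nonpos]
      rw [hm]
      simp only
      rw [intervalIntegral.integral_symm, neg_nonpos]
      exact intervalIntegral.integral_nonneg hs.2 fun r _ => hk0 r
    rw [intervalIntegral.integral_congr (g := fun s => k s * Real.exp (2 * (-1 * m s)))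
      fun s hs => congrArg (fun r => k s * Real.exp (2 * r)) (h1 s hs), key (-1) (by norm_num),
      h1 t right_mem_uIcc]
    have : 1 ≤ Real.exp (2 * (-1 * m t)) := by
      rw [← h1 t right_mem_uIcc]
      exact Real.one_le_exp (by positivity)
    rw [abs_of_nonpos (by linarith)]
    linarith

/-- Existence for the linear initial value problem `Y' = A Y + F`, `Y c = Y₀` with integrable
coefficients. The substitution `Y = exp (2 |∫ ‖A‖|) Z` turns the integral equation into a fixed
point problem for a contraction of the space of bounded continuous functions. -/
theorem exists_linear_integral_equation [CompleteSpace E] {A : ℝ → E →L[ℝ] E} {F : ℝ → E}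
    (hA : Integrable A) (hF : Integrable F) (c : ℝ) (Y₀ : E) :
    ∃ Y : ℝ → E, Integrable (fun s => A s (Y s) + F s) ∧
      ∀ t, Y t = Y₀ + ∫ s in c..t, (A s (Y s) + F s) := by
  set m : ℝ → ℝ := fun t => ∫ r in c..t, ‖A r‖ with hm
  set e : ℝ → ℝ := fun t => Real.exp (2 * |m t|) with he
  have hmc : Continuous m := hA.norm.continuous_primitive c
  have hec : Continuous e := Real.continuous_exp.comp ((hmc.abs).const_mul 2)
  have he1 : ∀ t, 1 ≤ e t := fun t => Real.one_le_exp (by positivity)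
  have he0 : ∀ t, 0 < e t := fun t => Real.exp_pos _
  have hmM : ∀ t, |m t| ≤ ∫ r, ‖A r‖ := fun t => by
    rw [hm]
    simp only
    rw [intervalIntegral.abs_intervalIntegral_eq,
      abs_of_nonneg (integral_nonneg fun r => norm_nonneg _)]
    exact setIntegral_le_integral hA.norm (Eventually.of_forall fun r => norm_nonneg _)
  set M := Real.exp (2 * ∫ r, ‖A r‖) with hM
  have heM : ∀ t, e t ≤ M := fun t => Real.exp_le_exp.2 (by linarith [hmM t])
  -- the integrand after the substitution is integrable for every bounded continuous `Z`
  have hint : ∀ Z : BoundedContinuousFunction ℝ E, Integrable (fun s => A s (e s • Z s)) := by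
    intro Z
    refine (hA.norm.mul_const (M * ‖Z‖)).mono' ?_ ?_
    · exact (ContinuousLinearMap.id ℝ (E →L[ℝ] E)).aestronglyMeasurable_comp₂ hA.aestronglyMeasurable
        (hec.smul Z.continuous).aestronglyMeasurable
    · refine Eventually.of_forall fun s => ((A s).le_opNorm _).trans ?_
      gcongr
      rw [norm_smul, Real.norm_of_nonneg (he0 s).le]
      exact mul_le_mul (heM s) (Z.norm_coe_le_norm s) (norm_nonneg _) (Real.exp_pos _).le
  have hint' : ∀ Z : BoundedContinuousFunction ℝ E, Integrable (fun s => A s (e s • Z s) + F s) :=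
    fun Z => (hint Z).add hF
  let T : BoundedContinuousFunction ℝ E → BoundedContinuousFunction ℝ E := fun Z =>
    BoundedContinuousFunction.ofNormedAddCommGroup
      (fun t => (e t)⁻¹ • (Y₀ + ∫ s in c..t, (A s (e s • Z s) + F s)))
      ((hec.inv₀ fun t => (he0 t).ne').smul
        (continuous_const.add ((hint' Z).continuous_primitive c)))
      (‖Y₀‖ + ∫ s, ‖A s (e s • Z s) + F s‖) (fun t => by
        rw [norm_smul, norm_inv, Real.norm_of_nonneg (he0 t).le]
        refine (mul_le_of_le_one_left (norm_nonneg _) (inv_le_one_of_one_le₀ (he1 t))).trans ?_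
        refine (norm_add_le _ _).trans ?_
        gcongr
        refine intervalIntegral.norm_integral_le_integral_norm_uIoc.trans ?_
        exact setIntegral_le_integral (hint' Z).norm
          (Eventually.of_forall fun r => norm_nonneg _))
  have hT : ContractingWith (1 / 2) T := by
    refine ⟨by rw [← NNReal.coe_lt_coe]; norm_num, LipschitzWith.of_dist_le_mul fun Z W => ?_⟩
    rw [BoundedContinuousFunction.dist_le (by positivity)]
    intro t
    have hdiff : T Z t - T W t = (e t)⁻¹ • ∫ s in c..t, A s (e s • (Z s - W s)) := by
      simp only [T, BoundedContinuousFunction.coe_ofNormedAddCommGroup]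
      rw [← smul_sub, add_sub_add_left_eq_sub,
        ← intervalIntegral.integral_sub (hint' Z).intervalIntegrable (hint' W).intervalIntegrable]
      congr 1
      refine intervalIntegral.integral_congr fun s _ => ?_
      simp only [smul_sub, map_sub]
      abel
    have hbound : ‖∫ s in c..t, A s (e s • (Z s - W s))‖ ≤ e t / 2 * dist Z W := by
      have hke : Integrable (fun s => ‖A s‖ * e s) := by
        refine hA.norm.mul_bdd (c := M) hec.aestronglyMeasurable (Eventually.of_forall fun s => ?_)
        rw [Real.norm_of_nonneg (he0 s).le]
        exact heM s
      refine (intervalIntegral.norm_integral_le_abs_of_norm_le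
        (g := fun s => ‖A s‖ * e s * dist Z W) ?_
        (hke.mul_const _).intervalIntegrable).trans ?_
      · refine Eventually.of_forall fun s => ((A s).le_opNorm _).trans ?_
        rw [norm_smul, Real.norm_of_nonneg (he0 s).le, mul_assoc]
        have := (he0 s).le
        gcongr
        rw [← dist_eq_norm]
        exact BoundedContinuousFunction.dist_coe_le_dist s
      · rw [intervalIntegral.integral_mul_const, abs_mul, abs_of_nonneg (dist_nonneg (x := Z))]
        gcongr
        exact abs_integral_mul_exp_le hA.norm (fun t => norm_nonneg _) c t
    rw [dist_eq_norm, hdiff, norm_smul, norm_inv, Real.norm_of_nonneg (he0 t).le]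
    calc (e t)⁻¹ * ‖∫ s in c..t, A s (e s • (Z s - W s))‖
        ≤ (e t)⁻¹ * (e t / 2 * dist Z W) := by
          gcongr
      _ = ((1 / 2 : NNReal) : ℝ) * dist Z W := by
          have := (he0 t).ne'
          push_cast
          field_simp
  have hfix := hT.fixedPoint_isFixedPt
  set Z := hT.fixedPoint T
  refine ⟨fun t => e t • Z t, hint' Z, fun t => ?_⟩
  have h := congrArg (fun W : BoundedContinuousFunction ℝ E => e t • W t) hfix
  simp only [T, BoundedContinuousFunction.coe_ofNormedAddCommGroup] at h
  rw [smul_inv_smul₀ (he0 t).ne'] at h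
  exact h.symm

end Caratheodory

/-! ### The initial value problem for the quasi-differential expression -/

section InitialValue

variable {a b : ℝ} {p Q : ℝ → ℝ}

theorem memLp_of_ac {u : ℝ → ℂ} (hab : a < b) (hu : AbsolutelyContinuousOnInterval u a b) :
    MemLp u 2 (volume.restrict (Ioo a b)) := by
  obtain ⟨C, hC⟩ := hu.exists_bound
  have hc := hu.continuousOn
  rw [uIcc_of_le hab.le] at hC hc
  refine MemLp.of_bound ((hc.mono Ioo_subset_Icc_self).aestronglyMeasurable measurableSet_Ioo) C ?_
  filter_upwards [ae_restrict_mem measurableSet_Ioo] with t ht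
  exact hC t (Ioo_subset_Icc_self ht)

/-- The equations `p u' - Q u = v` and `D²(u, v) = f` form a first order linear system for `(u, v)`
whose coefficients are combinations of `1 / p`, `Q / p` and `Q² / p`. -/
theorem exists_isQuasiRep (hab : a < b)
    (hp : ∀ᵐ t ∂volume.restrict (Ioo a b), p t ≠ 0)
    (h₁ : IntegrableOn (fun t => 1 / p t) (Ioo a b) volume)
    (h₂ : IntegrableOn (fun t => Q t / p t) (Ioo a b) volume)
    (h₃ : IntegrableOn (fun t => Q t ^ 2 / p t) (Ioo a b) volume)
    (f : L2 a b) (c : ℝ) (c₀ c₁ : ℂ) :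
    ∃ (y : L2 a b) (u v : ℝ → ℂ), IsQuasiRep p Q y u v ∧ u c = c₀ ∧ v c = c₁ ∧
      quasiDeriv₂ p Q u v =ᵐ[volume.restrict (Ioo a b)] f := by
  let M₁ : ℂ × ℂ →L[ℝ] ℂ × ℂ := (ContinuousLinearMap.snd ℝ ℂ ℂ).prod 0
  let M₂ : ℂ × ℂ →L[ℝ] ℂ × ℂ :=
    (ContinuousLinearMap.fst ℝ ℂ ℂ).prod (-ContinuousLinearMap.snd ℝ ℂ ℂ)
  let M₃ : ℂ × ℂ →L[ℝ] ℂ × ℂ := (0 : ℂ × ℂ →L[ℝ] ℂ).prod (-ContinuousLinearMap.fst ℝ ℂ ℂ)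
  let A : ℝ → ℂ × ℂ →L[ℝ] ℂ × ℂ := fun t =>
    (Ioo a b).indicator (fun t => 1 / p t) t • M₁ + (Ioo a b).indicator (fun t => Q t / p t) t • M₂ +
      (Ioo a b).indicator (fun t => Q t ^ 2 / p t) t • M₃
  let F : ℝ → ℂ × ℂ := fun t => (0, (Ioo a b).indicator (f : ℝ → ℂ) t)
  have hA : Integrable A :=
    ((((integrable_indicator_iff measurableSet_Ioo).2 h₁).smul_const M₁).add
      (((integrable_indicator_iff measurableSet_Ioo).2 h₂).smul_const M₂)).add
      (((integrable_indicator_iff measurableSet_Ioo).2 h₃).smul_const M₃)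
  have hf : Integrable ((Ioo a b).indicator (f : ℝ → ℂ)) :=
    (integrable_indicator_iff measurableSet_Ioo).2 ((Lp.memLp f).integrable one_le_two)
  have hF : Integrable F := (integrable_zero ℝ ℂ volume).prodMk hf
  obtain ⟨Y, hG, hY⟩ := exists_linear_integral_equation hA hF c (c₀, c₁)
  have hac : AbsolutelyContinuousOnInterval Y a b := by
    refine ac_of_dist_le (C := 1) (ac_primitive c hG) fun x _ y _ => ?_
    rw [hY x, hY y, dist_add_left, one_mul]
  have hu : AbsolutelyContinuousOnInterval (fun t => (Y t).1) a b :=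
    ac_comp_of_lipschitzWith LipschitzWith.prod_fst hac
  have hv : AbsolutelyContinuousOnInterval (fun t => (Y t).2) a b :=
    ac_comp_of_lipschitzWith LipschitzWith.prod_snd hac
  have hder : ∀ᵐ t ∂volume.restrict (Ioo a b),
      HasDerivAt (fun t => (Y t).1) ((1 / p t : ℝ) * (Y t).2 + (Q t / p t : ℝ) * (Y t).1) t ∧
      HasDerivAt (fun t => (Y t).2)
        (-((Q t / p t : ℝ) * (Y t).2) - (Q t ^ 2 / p t : ℝ) * (Y t).1 + f t) t := by
    rw [ae_restrict_iff' measurableSet_Ioo]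
    filter_upwards [ae_hasDerivAt_primitive c hG] with t ht hmem
    have h : HasDerivAt Y (A t (Y t) + F t) t := by
      have h := ht.const_add (c₀, c₁)
      rwa [← funext hY] at h
    have e : A t (Y t) + F t = ((1 / p t : ℝ) * (Y t).2 + (Q t / p t : ℝ) * (Y t).1,
        -((Q t / p t : ℝ) * (Y t).2) - (Q t ^ 2 / p t : ℝ) * (Y t).1 + f t) := by
      simp only [A, F, indicator_of_mem hmem, M₁, M₂, M₃]
      ext1
      · simp
      · simp
        ring
    rw [e] at h
    exact ⟨h.fst, h.snd⟩
  have hq₂ : quasiDeriv₂ p Q (fun t => (Y t).1) (fun t => (Y t).2)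
      =ᵐ[volume.restrict (Ioo a b)] f := by
    filter_upwards [hder] with t ht
    rw [quasiDeriv₂, ht.2.deriv]
    ring
  refine ⟨(memLp_of_ac hab hu).toLp _, fun t => (Y t).1, fun t => (Y t).2,
    ⟨hu, hv, MemLp.coeFn_toLp _, ?_, (memLp_congr_ae hq₂).2 (Lp.memLp f)⟩, ?_, ?_, hq₂⟩
  · filter_upwards [hder, hp] with t ht hpt
    have hpt' : (p t : ℂ) ≠ 0 := by exact_mod_cast hpt
    rw [quasiDeriv₁, ht.1.deriv]
    push_cast
    field_simp
    ring
  · simp [hY c]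
  · simp [hY c]

theorem exists_maxDomain_of_initial (hab : a < b)
    (hp : ∀ᵐ t ∂volume.restrict (Ioo a b), p t ≠ 0)
    (h₁ : IntegrableOn (fun t => 1 / p t) (Ioo a b) volume)
    (h₂ : IntegrableOn (fun t => Q t / p t) (Ioo a b) volume)
    (h₃ : IntegrableOn (fun t => Q t ^ 2 / p t) (Ioo a b) volume)
    (f : L2 a b) (c : Icc a b) (c₀ c₁ : ℂ) :
    ∃ y : maxDomain a b p Q, (Lmax a b p Q).toFun y = f ∧
      eval₀ hab c y = c₀ ∧ eval₁ hab c y = c₁ := by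
  obtain ⟨y, u, v, h, hu, hv, hq⟩ := exists_isQuasiRep hab hp h₁ h₂ h₃ (-f) c c₀ c₁
  refine ⟨⟨y, u, v, h⟩, ?_, ?_, ?_⟩
  · change -D₂ _ = f
    rw [neg_eq_iff_eq_neg, D₂]
    refine Lp.ext ((MemLp.coeFn_toLp _).trans ?_)
    exact ((isQuasiRep_D _).quasiDeriv₂_ae_eq h).trans hq
  · exact ((isQuasiRep_D ⟨y, u, v, h⟩).eqOn₀ hab h c.2).trans hu
  · exact ((isQuasiRep_D ⟨y, u, v, h⟩).eqOn₁ hab h c.2).trans hv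

end InitialValue

/-! ### The Lagrange identity -/

section Lagrange

variable {a b : ℝ} {p Q : ℝ → ℝ}

open scoped ComplexConjugate

theorem ac_conj {u : ℝ → ℂ} (hu : AbsolutelyContinuousOnInterval u a b) :
    AbsolutelyContinuousOnInterval (fun t => conj (u t)) a b :=
  ac_comp_of_lipschitzWith (C := 1) (LipschitzWith.of_dist_le_mul fun x y => by
    rw [Complex.dist_conj_conj, NNReal.coe_one, one_mul]) hu

/-- Almost everywhere `(conj v₁ * u₂ - conj u₁ * v₂)' = conj (D² y₁) * u₂ - conj u₁ * D² y₂`: the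
terms with `Q / p`, `Q² / p` and `1 / p` cancel because these coefficients are real. -/
theorem IsQuasiRep.hasDerivAt_wronskian {y₁ y₂ : L2 a b} {u₁ v₁ u₂ v₂ : ℝ → ℂ}
    (hp : ∀ᵐ t ∂volume.restrict (Ioo a b), p t ≠ 0)
    (h₁ : IsQuasiRep p Q y₁ u₁ v₁) (h₂ : IsQuasiRep p Q y₂ u₂ v₂) :
    ∀ᵐ t ∂volume.restrict (Ioo a b),
      HasDerivAt (fun t => conj (v₁ t) * u₂ t - conj (u₁ t) * v₂ t)
        (conj (quasiDeriv₂ p Q u₁ v₁ t) * u₂ t - conj (u₁ t) * quasiDeriv₂ p Q u₂ v₂ t) t := by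
  filter_upwards [hp, h₁.ae₁, h₂.ae₁, ae_differentiableAt_of_ac h₁.ac₀,
    ae_differentiableAt_of_ac h₁.ac₁, ae_differentiableAt_of_ac h₂.ac₀,
    ae_differentiableAt_of_ac h₂.ac₁] with t hpt e₁ e₂ du₁ dv₁ du₂ dv₂
  have hpt' : (p t : ℂ) ≠ 0 := by exact_mod_cast hpt
  have h := (dv₁.hasDerivAt.star.mul du₂.hasDerivAt).sub (du₁.hasDerivAt.star.mul dv₂.hasDerivAt)
  have hd : ∀ {u v : ℝ → ℂ}, v t = quasiDeriv₁ p Q u t →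
      deriv u t = ((1 / p t : ℝ) : ℂ) * v t + ((Q t / p t : ℝ) : ℂ) * u t := by
    intro u v e
    rw [e, quasiDeriv₁]
    push_cast
    field_simp
    ring
  refine h.congr_deriv ?_
  rw [hd e₁, hd e₂, quasiDeriv₂, quasiDeriv₂]
  simp only [Complex.star_def, map_add, map_mul, Complex.conj_ofReal]
  ring

theorem lagrange_identity_eval (hab : a < b)
    (hp : ∀ᵐ t ∂volume.restrict (Ioo a b), p t ≠ 0) (y z : maxDomain a b p Q) :
    inner ℂ ((Lmax a b p Q).toFun y) (z : L2 a b) - inner ℂ (y : L2 a b) ((Lmax a b p Q).toFun z) =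
      (conj (eval₁ hab ⟨a, left_mem_Icc.2 hab.le⟩ y) * eval₀ hab ⟨a, left_mem_Icc.2 hab.le⟩ z -
        conj (eval₀ hab ⟨a, left_mem_Icc.2 hab.le⟩ y) * eval₁ hab ⟨a, left_mem_Icc.2 hab.le⟩ z) -
      (conj (eval₁ hab ⟨b, right_mem_Icc.2 hab.le⟩ y) * eval₀ hab ⟨b, right_mem_Icc.2 hab.le⟩ z -
        conj (eval₀ hab ⟨b, right_mem_Icc.2 hab.le⟩ y) *
          eval₁ hab ⟨b, right_mem_Icc.2 hab.le⟩ z) := by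
  have hy := isQuasiRep_D y
  have hz := isQuasiRep_D z
  have hint : Integrable (fun t => inner ℂ (D₂ y t) ((z : L2 a b) t) -
      inner ℂ ((y : L2 a b) t) (D₂ z t)) (volume.restrict (Ioo a b)) :=
    (L2.integrable_inner (𝕜 := ℂ) (D₂ y) (z : L2 a b)).sub
      (L2.integrable_inner (𝕜 := ℂ) (y : L2 a b) (D₂ z))
  have hac : AbsolutelyContinuousOnInterval
      (fun t => conj (D₁ y t) * D₀ z t - conj (D₀ y t) * D₁ z t) a b :=
    ((ac_conj hy.ac₁).smul hz.ac₀).sub ((ac_conj hy.ac₀).smul hz.ac₁)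
  have h := integral_eq_sub_of_ac hab hac hint (by
    filter_upwards [hy.hasDerivAt_wronskian hp hz, hy.ae₀, hz.ae₀,
      (hy.memLp₂.coeFn_toLp : D₂ y =ᵐ[_] _), (hz.memLp₂.coeFn_toLp : D₂ z =ᵐ[_] _)]
      with t h1 h2 h3 h4 h5
    refine h1.congr_deriv ?_
    rw [h2, h3, ← h4, ← h5, RCLike.inner_apply', RCLike.inner_apply']
    rfl)
  rw [integral_sub (L2.integrable_inner (𝕜 := ℂ) (D₂ y) (z : L2 a b))
    (L2.integrable_inner (𝕜 := ℂ) (y : L2 a b) (D₂ z)), ← L2.inner_def, ← L2.inner_def] at h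
  change inner ℂ (-D₂ y) (z : L2 a b) - inner ℂ (y : L2 a b) (-D₂ z) = _
  rw [inner_neg_left, inner_neg_right]
  change _ = (conj (D₁ y a) * D₀ z a - conj (D₀ y a) * D₁ z a) -
    (conj (D₁ y b) * D₀ z b - conj (D₀ y b) * D₁ z b)
  linear_combination -h

theorem lagrange_identity (hab : a < b)
    (hp : ∀ᵐ t ∂volume.restrict (Ioo a b), p t ≠ 0) (y z : maxDomain a b p Q) :
    inner ℂ ((Lmax a b p Q).toFun y) (z : L2 a b) - inner ℂ (y : L2 a b) ((Lmax a b p Q).toFun z) =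
      inner ℂ (Γ₁ hab y) (Γ₂ hab z) - inner ℂ (Γ₂ hab y) (Γ₁ hab z) := by
  rw [lagrange_identity_eval hab hp]
  simp [Γ₁, Γ₂, pair, PiLp.inner_apply, Fin.sum_univ_two]
  ring

end Lagrange

/-! ### Boundary values and the adjoint of the minimal operator -/

section Boundary

variable {a b : ℝ} {p Q : ℝ → ℝ}

/-- Functions vanishing at `a` together with their quasi-derivative attain all values at `b`. By the
Lagrange identity, a vector orthogonal to all these values would give, as initial value at `b`, a
solution `z` of `L_max z = 0` orthogonal to the whole of `L₂`. -/
theorem exists_maxDomain_of_boundary_right (hab : a < b)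
    (hp : ∀ᵐ t ∂volume.restrict (Ioo a b), p t ≠ 0)
    (h₁ : IntegrableOn (fun t => 1 / p t) (Ioo a b) volume)
    (h₂ : IntegrableOn (fun t => Q t / p t) (Ioo a b) volume)
    (h₃ : IntegrableOn (fun t => Q t ^ 2 / p t) (Ioo a b) volume) (x : C2) :
    ∃ y : maxDomain a b p Q, eval₀ hab ⟨a, left_mem_Icc.2 hab.le⟩ y = 0 ∧
      eval₁ hab ⟨a, left_mem_Icc.2 hab.le⟩ y = 0 ∧
      eval₀ hab ⟨b, right_mem_Icc.2 hab.le⟩ y = x 0 ∧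
      eval₁ hab ⟨b, right_mem_Icc.2 hab.le⟩ y = x 1 := by
  set A : Icc a b := ⟨a, left_mem_Icc.2 hab.le⟩ with hA
  set B : Icc a b := ⟨b, right_mem_Icc.2 hab.le⟩ with hB
  let W : Submodule ℂ C2 :=
    (LinearMap.ker (eval₀ (p := p) (Q := Q) hab A) ⊓ LinearMap.ker (eval₁ hab A)).map
      (pair (eval₀ hab B) (eval₁ hab B))
  have hW : W = ⊤ := by
    rw [← Submodule.orthogonal_eq_bot_iff, Submodule.eq_bot_iff]
    intro c hc
    obtain ⟨z, hz, hz₀, hz₁⟩ := exists_maxDomain_of_initial hab hp h₁ h₂ h₃ 0 B (c 1) (-c 0)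
    obtain ⟨y, hy, hy₀, hy₁⟩ := exists_maxDomain_of_initial hab hp h₁ h₂ h₃ (z : L2 a b) A 0 0
    have horth : inner ℂ (pair (eval₀ hab B) (eval₁ hab B) y) c = 0 :=
      (Submodule.mem_orthogonal W c).1 hc _ (Submodule.mem_map_of_mem ⟨hy₀, hy₁⟩)
    have hlag := lagrange_identity_eval hab hp y z
    rw [← hA, ← hB, hy, hz, hy₀, hy₁, hz₀, hz₁] at hlag
    simp [pair, PiLp.inner_apply, Fin.sum_univ_two] at horth
    rw [inner_zero_right, sub_zero, map_zero, zero_mul, zero_mul, sub_zero] at hlag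
    have hzz : inner ℂ (z : L2 a b) (z : L2 a b) = 0 := by
      linear_combination hlag - horth
    have hz' : z = 0 := Subtype.ext (inner_self_eq_zero.1 hzz)
    rw [hz', map_zero] at hz₀ hz₁
    ext i
    fin_cases i
    · simpa using hz₁.symm
    · simpa using hz₀.symm
  obtain ⟨y, ⟨hy₀, hy₁⟩, hy⟩ : x ∈ W := hW ▸ Submodule.mem_top
  refine ⟨y, hy₀, hy₁, ?_, ?_⟩ <;> simp [← hy, pair]

/-- The boundary map `(Γ₁, Γ₂)` is onto: a solution of the homogeneous equation takes the values
prescribed at `a`, and its values at `b` are corrected by a function vanishing at `a`. -/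
theorem exists_maxDomain_of_boundary (hab : a < b)
    (hp : ∀ᵐ t ∂volume.restrict (Ioo a b), p t ≠ 0)
    (h₁ : IntegrableOn (fun t => 1 / p t) (Ioo a b) volume)
    (h₂ : IntegrableOn (fun t => Q t / p t) (Ioo a b) volume)
    (h₃ : IntegrableOn (fun t => Q t ^ 2 / p t) (Ioo a b) volume) (x₁ x₂ : C2) :
    ∃ y : maxDomain a b p Q, Γ₁ hab y = x₁ ∧ Γ₂ hab y = x₂ := by
  obtain ⟨y, -, hy₀, hy₁⟩ := exists_maxDomain_of_initial hab hp h₁ h₂ h₃ 0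
    ⟨a, left_mem_Icc.2 hab.le⟩ (x₂ 0) (x₁ 0)
  obtain ⟨z, ha₀, ha₁, hb₀, hb₁⟩ := exists_maxDomain_of_boundary_right hab hp h₁ h₂ h₃
    !₂[x₂ 1 - eval₀ hab ⟨b, right_mem_Icc.2 hab.le⟩ y,
      -x₁ 1 - eval₁ hab ⟨b, right_mem_Icc.2 hab.le⟩ y]
  refine ⟨y + z, ?_, ?_⟩
  · ext i
    fin_cases i <;> simp [Γ₁, pair, hy₁, ha₁, hb₁]
  · ext i
    fin_cases i <;> simp [Γ₂, pair, hy₀, ha₀, hb₀]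

theorem mem_minDomain_iff (hab : a < b) (y : maxDomain a b p Q) :
    y ∈ minDomain hab p Q ↔ Γ₁ hab y = 0 ∧ Γ₂ hab y = 0 := by
  constructor
  · rintro ⟨h1, h2, h3, h4⟩
    constructor <;> ext i <;> fin_cases i <;> simp [Γ₁, Γ₂, pair, h1, h2, h3, h4]
  · rintro ⟨h, h'⟩
    have e₁ := fun i => congrArg (fun x : C2 => x i) h
    have e₂ := fun i => congrArg (fun x : C2 => x i) h'
    refine ⟨?_, ?_, ?_, ?_⟩
    · simpa [Γ₂, pair] using e₂ 0
    · simpa [Γ₁, pair] using e₁ 0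
    · simpa [Γ₂, pair] using e₂ 1
    · simpa [Γ₁, pair] using e₁ 1

/-- The adjoint of the minimal operator is contained in the maximal one. If `u` solves
`L_max u = w`, then `z - u` is orthogonal to the range of `L_min`; this range contains the
orthogonal complement of two solutions of the homogeneous equation, so `z - u` lies in their
span. -/
theorem exists_maxDomain_of_inner_minDomain (hab : a < b)
    (hp : ∀ᵐ t ∂volume.restrict (Ioo a b), p t ≠ 0)
    (h₁ : IntegrableOn (fun t => 1 / p t) (Ioo a b) volume)
    (h₂ : IntegrableOn (fun t => Q t / p t) (Ioo a b) volume)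
    (h₃ : IntegrableOn (fun t => Q t ^ 2 / p t) (Ioo a b) volume) {z w : L2 a b}
    (h : ∀ y ∈ minDomain hab p Q,
      inner ℂ w (y : L2 a b) = inner ℂ z ((Lmax a b p Q).toFun y)) :
    ∃ y : maxDomain a b p Q, (y : L2 a b) = z ∧ (Lmax a b p Q).toFun y = w := by
  set A : Icc a b := ⟨a, left_mem_Icc.2 hab.le⟩ with hA
  set B : Icc a b := ⟨b, right_mem_Icc.2 hab.le⟩ with hB
  obtain ⟨u, hu, -, -⟩ := exists_maxDomain_of_initial hab hp h₁ h₂ h₃ w A 0 0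
  obtain ⟨e, he, he₀, he₁⟩ := exists_maxDomain_of_initial hab hp h₁ h₂ h₃ 0 B 1 0
  obtain ⟨f, hf, hf₀, hf₁⟩ := exists_maxDomain_of_initial hab hp h₁ h₂ h₃ 0 B 0 1
  let N : Submodule ℂ (L2 a b) := Submodule.span ℂ {(e : L2 a b), (f : L2 a b)}
  have : FiniteDimensional ℂ N := FiniteDimensional.span_of_finite ℂ (by simp)
  have hN : N ≤ (LinearMap.ker (Lmax a b p Q).toFun).map (maxDomain a b p Q).subtype := by
    rw [Submodule.span_le]
    rintro x (rfl | rfl)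
    · exact ⟨e, he, rfl⟩
    · exact ⟨f, hf, rfl⟩
  have hmem : z - u ∈ N := by
    rw [← Submodule.orthogonal_orthogonal N, Submodule.mem_orthogonal']
    intro g hg
    obtain ⟨y, hy, hy₀, hy₁⟩ := exists_maxDomain_of_initial hab hp h₁ h₂ h₃ g A 0 0
    have hge : inner ℂ g (e : L2 a b) = 0 :=
      (Submodule.mem_orthogonal' N g).1 hg _ (Submodule.subset_span (by simp))
    have hgf : inner ℂ g (f : L2 a b) = 0 :=
      (Submodule.mem_orthogonal' N g).1 hg _ (Submodule.subset_span (by simp))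
    have l₁ := lagrange_identity_eval hab hp y e
    have l₂ := lagrange_identity_eval hab hp y f
    rw [← hA, ← hB, hy, he, hy₀, hy₁, he₀, he₁, hge] at l₁
    rw [← hA, ← hB, hy, hf, hy₀, hy₁, hf₀, hf₁, hgf] at l₂
    have hmin : y ∈ minDomain hab p Q :=
      ⟨hy₀, hy₁, by simpa using l₂.symm, by simpa using l₁.symm⟩
    have hΓ := (mem_minDomain_iff hab y).1 hmin
    have l₃ := lagrange_identity hab hp u y
    rw [hΓ.1, hΓ.2, inner_zero_right, inner_zero_right, sub_zero, hu, hy, h y hmin, hy] at l₃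
    rwa [inner_sub_left]
  obtain ⟨k, hk, hk'⟩ := hN hmem
  refine ⟨u + k, ?_, ?_⟩
  · have : (k : L2 a b) = z - u := hk'
    simp [this]
  · have hk₀ : (Lmax a b p Q).toFun k = 0 := hk
    exact ((Lmax a b p Q).toFun.map_add u k).trans
      ((congrArg₂ (· + ·) hu hk₀).trans (add_zero w))

end Boundary

/-! ### Unitary operators and self-dual boundary conditions -/

section Cayley

variable {H : Type*} [NormedAddCommGroup H] [InnerProductSpace ℂ H]

theorem boundary_condition_iff (K : H →L[ℂ] H) (x₁ x₂ : H) :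
    (K - 1) x₁ + Complex.I • (K + 1) x₂ = 0 ↔
      K (x₁ + Complex.I • x₂) = x₁ - Complex.I • x₂ := by
  rw [← sub_eq_zero (a := K (x₁ + Complex.I • x₂))]
  have h : (K - 1) x₁ + Complex.I • (K + 1) x₂ =
      K (x₁ + Complex.I • x₂) - (x₁ - Complex.I • x₂) := by
    simp only [sub_apply, add_apply,
      one_apply_eq_self, map_add, map_smul, smul_add]
    abel
  rw [h]

/-- In the coordinates `x₁ ± i x₂` the form `⟪x₁, y₂⟫ - ⟪x₂, y₁⟫` is, up to a factor, the difference
of two inner products. -/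
theorem inner_cayley (x₁ x₂ y₁ y₂ : H) :
    inner ℂ (x₁ + Complex.I • x₂) (y₁ + Complex.I • y₂) -
      inner ℂ (x₁ - Complex.I • x₂) (y₁ - Complex.I • y₂) =
      2 * Complex.I * (inner ℂ x₁ y₂ - inner ℂ x₂ y₁) := by
  simp only [inner_add_left, inner_add_right, inner_sub_left, inner_sub_right, inner_smul_left,
    inner_smul_right, Complex.conj_I]
  ring

/-- Every pair `(s, r)` has the form `(x₁ + i x₂, x₁ - i x₂)`. -/
theorem exists_cayley_coordinates (s r : H) :
    ∃ x₁ x₂ : H, x₁ + Complex.I • x₂ = s ∧ x₁ - Complex.I • x₂ = r := by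
  refine ⟨(2⁻¹ : ℂ) • (s + r), (-Complex.I * 2⁻¹) • (s - r), ?_, ?_⟩ <;>
  · rw [smul_smul, show Complex.I * (-Complex.I * 2⁻¹) = (2⁻¹ : ℂ) by
      linear_combination (-(2⁻¹ : ℂ)) * Complex.I_mul_I]
    module

theorem eq_of_cayley_coordinates_eq {x y : H × H}
    (h : x.1 + Complex.I • x.2 = y.1 + Complex.I • y.2)
    (h' : x.1 - Complex.I • x.2 = y.1 - Complex.I • y.2) : x = y := by
  have e : x.1 = y.1 := by
    have := congrArg₂ (fun u v => (2⁻¹ : ℂ) • (u + v)) h h'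
    convert this using 1 <;> module
  rw [e] at h
  exact Prod.ext e (smul_right_injective H Complex.I_ne_zero (add_left_cancel h))

variable [CompleteSpace H]

theorem surjective_of_mem_unitary {K : H →L[ℂ] H} (hK : K ∈ unitary (H →L[ℂ] H)) :
    Function.Surjective K := fun x =>
  ⟨star K x, by
    rw [← mul_apply_eq_comp, (Unitary.mem_iff.1 hK).2, one_apply_eq_self]⟩

/-- The subspace `K (x₁ + i x₂) = x₁ - i x₂` attached to a unitary `K` is its own annihilator for
the form `⟪x₁, y₂⟫ - ⟪x₂, y₁⟫`. -/
theorem self_dual_of_mem_unitary {K : H →L[ℂ] H} (hK : K ∈ unitary (H →L[ℂ] H)) (y₁ y₂ : H) :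
    K (y₁ + Complex.I • y₂) = y₁ - Complex.I • y₂ ↔
      ∀ x₁ x₂ : H, K (x₁ + Complex.I • x₂) = x₁ - Complex.I • x₂ →
        inner ℂ x₁ y₂ - inner ℂ x₂ y₁ = 0 := by
  have h2 : (2 * Complex.I : ℂ) ≠ 0 := by simp
  constructor
  · intro hy x₁ x₂ hx
    have h := inner_cayley x₁ x₂ y₁ y₂
    rw [← hx, ← hy, ContinuousLinearMap.inner_map_map_of_mem_unitary hK, sub_self] at h
    exact (mul_eq_zero.1 h.symm).resolve_left h2
  · intro h
    rw [← sub_eq_zero]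
    -- test with the element of the subspace whose image under `K` is the defect of `y`
    obtain ⟨s, hs⟩ := surjective_of_mem_unitary hK
      (K (y₁ + Complex.I • y₂) - (y₁ - Complex.I • y₂))
    obtain ⟨x₁, x₂, hx, hx'⟩ := exists_cayley_coordinates s (K s)
    have h' := inner_cayley x₁ x₂ y₁ y₂
    rw [h x₁ x₂ (by rw [hx, hx']), mul_zero, hx, hx',
      ← ContinuousLinearMap.inner_map_map_of_mem_unitary hK,
      ← inner_sub_right, hs] at h'
    exact inner_self_eq_zero.1 h'

/-- A subspace that is its own annihilator for the form `⟪x₁, y₂⟫ - ⟪x₂, y₁⟫` is the graph of a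
unitary operator in the coordinates `x₁ ± i x₂`. Isotropy makes `x₁ + i x₂ ↦ x₁ - i x₂` isometric;
if `z` is orthogonal to all `x₁ + i x₂`, then `(i z, z)` annihilates the subspace, hence belongs to
it, which forces `z = 0`. -/
theorem exists_unitary_of_self_dual [FiniteDimensional ℂ H] (Θ : Submodule ℂ (H × H))
    (hΘ : ∀ y, y ∈ Θ ↔ ∀ x ∈ Θ, inner ℂ x.1 y.2 - inner ℂ x.2 y.1 = 0) :
    ∃ K ∈ unitary (H →L[ℂ] H),
      ∀ y, y ∈ Θ ↔ K (y.1 + Complex.I • y.2) = y.1 - Complex.I • y.2 := by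
  let P : Θ →ₗ[ℂ] H := (LinearMap.fst ℂ H H + Complex.I • LinearMap.snd ℂ H H).comp Θ.subtype
  let M : Θ →ₗ[ℂ] H := (LinearMap.fst ℂ H H - Complex.I • LinearMap.snd ℂ H H).comp Θ.subtype
  have hP : ∀ x : Θ, P x = x.1.1 + Complex.I • x.1.2 := fun x => rfl
  have hM : ∀ x : Θ, M x = x.1.1 - Complex.I • x.1.2 := fun x => rfl
  have hinner : ∀ x y : Θ, inner ℂ (P x) (P y) = inner ℂ (M x) (M y) := fun x y => by
    have h := inner_cayley x.1.1 x.1.2 y.1.1 y.1.2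
    rw [(hΘ y).1 y.2 x x.2, mul_zero] at h
    exact sub_eq_zero.1 h
  have hnorm : ∀ x : Θ, ‖M x‖ = ‖P x‖ := fun x => by
    rw [@norm_eq_sqrt_re_inner ℂ, @norm_eq_sqrt_re_inner ℂ _ _ _ _ (P x), hinner]
  have hinj : Function.Injective P := fun x y hxy => by
    refine Subtype.ext (eq_of_cayley_coordinates_eq hxy ?_)
    rw [← hM, ← hM, ← sub_eq_zero, ← map_sub, ← norm_eq_zero, hnorm, map_sub, hxy,
      sub_self, norm_zero]
  have hsurj : Function.Surjective P := by
    rw [← LinearMap.range_eq_top, ← Submodule.orthogonal_eq_bot_iff, Submodule.eq_bot_iff]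
    intro z hz
    have hz' : ∀ x : Θ, inner ℂ (P x) z = 0 := fun x =>
      (Submodule.mem_orthogonal _ z).1 hz _ (LinearMap.mem_range_self P x)
    have hw : (Complex.I • z, z) ∈ Θ := by
      rw [hΘ]
      intro x hx
      have h := hz' ⟨x, hx⟩
      rw [hP, inner_add_left, inner_smul_left, Complex.conj_I] at h
      rw [inner_smul_right]
      linear_combination h
    have h := hz' ⟨_, hw⟩
    rw [hP, ← two_smul ℂ, inner_smul_left, inner_smul_left] at h
    simpa using h
  let e : Θ ≃ₗ[ℂ] H := LinearEquiv.ofBijective P ⟨hinj, hsurj⟩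
  have he : ∀ x, P (e.symm x) = x := fun x => e.apply_symm_apply x
  let U : H →ₗᵢ[ℂ] H := ⟨M.comp e.symm.toLinearMap, fun x => by
    change ‖M (e.symm x)‖ = ‖x‖
    rw [hnorm, he]⟩
  let V : H ≃ₗᵢ[ℂ] H := U.toLinearIsometryEquiv rfl
  have hU : ∀ x, (Unitary.linearIsometryEquiv.symm V : H →L[ℂ] H) x = M (e.symm x) := fun x => rfl
  refine ⟨Unitary.linearIsometryEquiv.symm V, (Unitary.linearIsometryEquiv.symm V).2, fun y => ?_⟩
  rw [hU]
  constructor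
  · intro hy
    have : e.symm (y.1 + Complex.I • y.2) = ⟨y, hy⟩ := e.symm_apply_apply ⟨y, hy⟩
    rw [this, hM]
  · intro h
    have hx : (e.symm (y.1 + Complex.I • y.2)).1 = y := eq_of_cayley_coordinates_eq (he _) h
    rw [← hx]
    exact Subtype.coe_prop _

end Cayley

/-! ### Restrictions of the maximal operator -/

section Restriction

variable {a b : ℝ} {p Q : ℝ → ℝ}

/-- The restriction of `L_max` to a subspace of its domain. -/
noncomputable abbrev restrictMax (D : Submodule ℂ (maxDomain a b p Q)) : L2 a b →ₗ.[ℂ] L2 a b :=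
  (Lmax a b p Q).domRestrict (D.map (maxDomain a b p Q).subtype)

theorem mem_restrictMax_domain {D : Submodule ℂ (maxDomain a b p Q)} {x : L2 a b} :
    x ∈ (restrictMax D).domain ↔ ∃ y ∈ D, (y : L2 a b) = x := by
  constructor
  · rintro ⟨⟨y, hy, rfl⟩, -⟩
    exact ⟨y, hy, rfl⟩
  · rintro ⟨y, hy, rfl⟩
    exact ⟨⟨y, hy, rfl⟩, y.2⟩

theorem restrictMax_apply {D : Submodule ℂ (maxDomain a b p Q)} (x : (restrictMax D).domain)
    {y : maxDomain a b p Q} (h : (y : L2 a b) = x) :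
    restrictMax D x = (Lmax a b p Q).toFun y :=
  (LinearPMap.domRestrict_le (f := Lmax a b p Q)).2 (x := x) (y := y) h.symm

theorem restrictMax_mono {D D' : Submodule ℂ (maxDomain a b p Q)} (h : D ≤ D') :
    restrictMax D ≤ restrictMax D' := by
  constructor
  · intro x hx
    obtain ⟨y, hy, rfl⟩ := mem_restrictMax_domain.1 hx
    exact mem_restrictMax_domain.2 ⟨y, h hy, rfl⟩
  · intro x x' hx
    obtain ⟨y, -, hy⟩ := mem_restrictMax_domain.1 x.2
    rw [restrictMax_apply x hy, restrictMax_apply x' (hy.trans hx)]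

theorem restrictMax_injective :
    Function.Injective (restrictMax (a := a) (b := b) (p := p) (Q := Q)) := by
  have key : ∀ {D D' : Submodule ℂ (maxDomain a b p Q)}, restrictMax D = restrictMax D' →
      D ≤ D' := by
    intro D D' h y hy
    have hmem : (y : L2 a b) ∈ (restrictMax D').domain :=
      h ▸ mem_restrictMax_domain.2 ⟨y, hy, rfl⟩
    obtain ⟨z, hz, hzy⟩ := mem_restrictMax_domain.1 hmem
    rwa [← Subtype.ext hzy]
  exact fun D D' h => le_antisymm (key h) (key h.symm)

/-- An element `z` orthogonal to `Dom(L_min)` formally satisfies `(L_min)* 0 = z`, so `z` equals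
`L_max 0`. -/
theorem dense_restrictMax_domain (hab : a < b)
    (hp : ∀ᵐ t ∂volume.restrict (Ioo a b), p t ≠ 0)
    (h₁ : IntegrableOn (fun t => 1 / p t) (Ioo a b) volume)
    (h₂ : IntegrableOn (fun t => Q t / p t) (Ioo a b) volume)
    (h₃ : IntegrableOn (fun t => Q t ^ 2 / p t) (Ioo a b) volume)
    {D : Submodule ℂ (maxDomain a b p Q)} (hD : minDomain hab p Q ≤ D) :
    Dense ((restrictMax D).domain : Set (L2 a b)) := by
  rw [Submodule.dense_iff_topologicalClosure_eq_top, Submodule.topologicalClosure_eq_top_iff,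
    Submodule.eq_bot_iff]
  intro w hw
  obtain ⟨y, hy, hyw⟩ := exists_maxDomain_of_inner_minDomain hab hp h₁ h₂ h₃ (z := 0) (w := w)
    (fun y hy => by
      rw [inner_zero_left]
      exact (Submodule.mem_orthogonal' _ w).1 hw _ (mem_restrictMax_domain.2 ⟨y, hD hy, rfl⟩))
  rw [← hyw, show y = 0 from Subtype.ext hy]
  exact LinearMap.map_zero _

/-- If a subspace `D ⊇ Dom(L_min)` is its own annihilator for the boundary form, then the Lagrange
identity makes the restriction of `L_max` to `D` symmetric, and forces every element of the domain
of its adjoint, which lies in `Dom(L_max)`, into `D`. -/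
theorem isSelfAdjoint_restrictMax (hab : a < b)
    (hp : ∀ᵐ t ∂volume.restrict (Ioo a b), p t ≠ 0)
    (h₁ : IntegrableOn (fun t => 1 / p t) (Ioo a b) volume)
    (h₂ : IntegrableOn (fun t => Q t / p t) (Ioo a b) volume)
    (h₃ : IntegrableOn (fun t => Q t ^ 2 / p t) (Ioo a b) volume)
    {D : Submodule ℂ (maxDomain a b p Q)} (hD : minDomain hab p Q ≤ D)
    (h : ∀ z, z ∈ D ↔ ∀ y ∈ D,
      inner ℂ (Γ₁ hab y) (Γ₂ hab z) - inner ℂ (Γ₂ hab y) (Γ₁ hab z) = 0) :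
    IsSelfAdjoint (restrictMax D) := by
  have hdense := dense_restrictMax_domain hab hp h₁ h₂ h₃ hD
  rw [LinearPMap.isSelfAdjoint_def]
  refine le_antisymm ?_ (LinearPMap.IsFormalAdjoint.le_adjoint hdense ?_)
  · have key : ∀ x : (restrictMax D).adjoint.domain, ∃ y ∈ D, (y : L2 a b) = x ∧
        (Lmax a b p Q).toFun y = (restrictMax D).adjoint x := by
      intro x
      have hx : ∀ y ∈ D, inner ℂ ((restrictMax D).adjoint x) (y : L2 a b) =
          inner ℂ (x : L2 a b) ((Lmax a b p Q).toFun y) := by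
        intro y hy
        have hadj := LinearPMap.adjoint_isFormalAdjoint hdense x
          ⟨y, mem_restrictMax_domain.2 ⟨y, hy, rfl⟩⟩
        rwa [restrictMax_apply _ rfl] at hadj
      obtain ⟨z, hz, hzx⟩ :=
        exists_maxDomain_of_inner_minDomain hab hp h₁ h₂ h₃ fun y hy => hx y (hD hy)
      refine ⟨z, (h z).2 fun y hy => ?_, hz, hzx⟩
      rw [← lagrange_identity hab hp, hzx, hz, sub_eq_zero, ← inner_conj_symm,
        ← inner_conj_symm (y : L2 a b), hx y hy]
    constructor
    · intro x hx
      obtain ⟨y, hy, hyx, -⟩ := key ⟨x, hx⟩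
      exact mem_restrictMax_domain.2 ⟨y, hy, hyx⟩
    · intro x x' hxx'
      obtain ⟨y, -, hyx, hy⟩ := key x
      rw [restrictMax_apply x' (hyx.trans hxx'), hy]
  · intro x x'
    obtain ⟨y, hy, hyx⟩ := mem_restrictMax_domain.1 x.2
    obtain ⟨z, hz, hzx⟩ := mem_restrictMax_domain.1 x'.2
    rw [restrictMax_apply x hyx, restrictMax_apply x' hzx, ← hyx, ← hzx, ← sub_eq_zero,
      lagrange_identity hab hp]
    exact (h z).1 hz y hy

/-- A self-adjoint extension `L` of `L_min` satisfies `L = L* ≤ (L_min)* = L_max`, and its domain is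
its own annihilator for the boundary form because `L* = L`. -/
theorem exists_eq_restrictMax (hab : a < b)
    (hp : ∀ᵐ t ∂volume.restrict (Ioo a b), p t ≠ 0)
    (h₁ : IntegrableOn (fun t => 1 / p t) (Ioo a b) volume)
    (h₂ : IntegrableOn (fun t => Q t / p t) (Ioo a b) volume)
    (h₃ : IntegrableOn (fun t => Q t ^ 2 / p t) (Ioo a b) volume)
    {L : L2 a b →ₗ.[ℂ] L2 a b} (hL : Lmin hab p Q ≤ L) (hsa : IsSelfAdjoint L) :
    ∃ D : Submodule ℂ (maxDomain a b p Q), L = restrictMax D ∧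
      ∀ z, z ∈ D ↔ ∀ y ∈ D,
        inner ℂ (Γ₁ hab y) (Γ₂ hab z) - inner ℂ (Γ₂ hab y) (Γ₁ hab z) = 0 := by
  have hdense := hsa.dense_domain
  have hsymm : L.IsFormalAdjoint L := by
    have h := LinearPMap.adjoint_isFormalAdjoint hdense
    rwa [LinearPMap.isSelfAdjoint_def.1 hsa] at h
  have hmin : ∀ y : maxDomain a b p Q, y ∈ minDomain hab p Q →
      ∃ hy : (y : L2 a b) ∈ L.domain, L ⟨y, hy⟩ = (Lmax a b p Q).toFun y := by
    intro y hy
    have hy' : (y : L2 a b) ∈ (restrictMax (minDomain hab p Q)).domain :=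
      mem_restrictMax_domain.2 ⟨y, hy, rfl⟩
    exact ⟨hL.1 hy', (hL.2 (x := ⟨y, hy'⟩) rfl).symm.trans (restrictMax_apply _ rfl)⟩
  have hmax : ∀ x : L.domain, ∃ y : maxDomain a b p Q, (y : L2 a b) = x ∧
      (Lmax a b p Q).toFun y = L x := by
    intro x
    refine exists_maxDomain_of_inner_minDomain hab hp h₁ h₂ h₃ fun y hy => ?_
    obtain ⟨hy', hLy⟩ := hmin y hy
    rw [← hLy]
    exact hsymm x ⟨y, hy'⟩
  have hval : ∀ (y : maxDomain a b p Q) (hy : (y : L2 a b) ∈ L.domain),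
      L ⟨y, hy⟩ = (Lmax a b p Q).toFun y := by
    intro y hy
    obtain ⟨z, hz, hLz⟩ := hmax ⟨y, hy⟩
    rw [← hLz, show z = y from Subtype.ext hz]
  refine ⟨L.domain.comap (maxDomain a b p Q).subtype, ?_, fun z => ⟨fun hz y hy => ?_, fun h => ?_⟩⟩
  · refine LinearPMap.ext ?_ ?_
    · ext x
      rw [mem_restrictMax_domain]
      constructor
      · intro hx
        obtain ⟨y, hy, -⟩ := hmax ⟨x, hx⟩
        have hy' : (y : L2 a b) = x := hy
        exact ⟨y, by rwa [Submodule.mem_comap, Submodule.subtype_apply, hy'], hy'⟩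
      · rintro ⟨y, hy, rfl⟩
        exact hy
    · intro x hx hx'
      obtain ⟨y, hy, hLy⟩ := hmax ⟨x, hx⟩
      rw [restrictMax_apply ⟨x, hx'⟩ (y := y) hy, hLy]
  · rw [← lagrange_identity hab hp, ← hval y hy, ← hval z hz, sub_eq_zero]
    exact hsymm ⟨y, hy⟩ ⟨z, hz⟩
  · change (z : L2 a b) ∈ L.domain
    rw [← LinearPMap.isSelfAdjoint_def.1 hsa]
    refine LinearPMap.mem_adjoint_domain_of_exists _ ⟨(Lmax a b p Q).toFun z, fun x => ?_⟩
    obtain ⟨y, hy, hLy⟩ := hmax x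
    have hyD : (y : L2 a b) ∈ L.domain := hy ▸ x.2
    have h' := h y hyD
    rw [← lagrange_identity hab hp, hLy, hy, sub_eq_zero] at h'
    rw [← inner_conj_symm, ← h', inner_conj_symm]

theorem mem_boundaryDomain_iff (hab : a < b) (K : C2 →L[ℂ] C2) (y : maxDomain a b p Q) :
    y ∈ boundaryDomain hab p Q K ↔
      K (Γ₁ hab y + Complex.I • Γ₂ hab y) = Γ₁ hab y - Complex.I • Γ₂ hab y :=
  boundary_condition_iff K (Γ₁ hab y) (Γ₂ hab y)

theorem minDomain_le_boundaryDomain (hab : a < b) (K : C2 →L[ℂ] C2) :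
    minDomain hab p Q ≤ boundaryDomain hab p Q K := by
  intro y hy
  obtain ⟨e₁, e₂⟩ := (mem_minDomain_iff hab y).1 hy
  rw [mem_boundaryDomain_iff, e₁, e₂]
  simp

theorem isSelfAdjoint_LK (hab : a < b)
    (hp : ∀ᵐ t ∂volume.restrict (Ioo a b), p t ≠ 0)
    (h₁ : IntegrableOn (fun t => 1 / p t) (Ioo a b) volume)
    (h₂ : IntegrableOn (fun t => Q t / p t) (Ioo a b) volume)
    (h₃ : IntegrableOn (fun t => Q t ^ 2 / p t) (Ioo a b) volume)
    {K : C2 →L[ℂ] C2} (hK : K ∈ unitary (C2 →L[ℂ] C2)) : IsSelfAdjoint (LK hab p Q K) := by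
  refine isSelfAdjoint_restrictMax hab hp h₁ h₂ h₃ (minDomain_le_boundaryDomain hab K) fun z => ?_
  rw [mem_boundaryDomain_iff, self_dual_of_mem_unitary hK]
  constructor
  · intro h y hy
    exact h _ _ ((mem_boundaryDomain_iff hab K y).1 hy)
  · intro h x₁ x₂ hx
    obtain ⟨y, rfl, rfl⟩ := exists_maxDomain_of_boundary hab hp h₁ h₂ h₃ x₁ x₂
    exact h y ((mem_boundaryDomain_iff hab K y).2 hx)

theorem exists_eq_LK (hab : a < b)
    (hp : ∀ᵐ t ∂volume.restrict (Ioo a b), p t ≠ 0)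
    (h₁ : IntegrableOn (fun t => 1 / p t) (Ioo a b) volume)
    (h₂ : IntegrableOn (fun t => Q t / p t) (Ioo a b) volume)
    (h₃ : IntegrableOn (fun t => Q t ^ 2 / p t) (Ioo a b) volume)
    {L : L2 a b →ₗ.[ℂ] L2 a b} (hL : Lmin hab p Q ≤ L) (hsa : IsSelfAdjoint L) :
    ∃ K ∈ unitary (C2 →L[ℂ] C2), L = LK hab p Q K := by
  obtain ⟨D, rfl, hD⟩ := exists_eq_restrictMax hab hp h₁ h₂ h₃ hL hsa
  obtain ⟨Θ, hΘ⟩ : ∃ Θ : Submodule ℂ (C2 × C2),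
      ∀ x, x ∈ Θ ↔ ∃ y ∈ D, Γ₁ hab y = x.1 ∧ Γ₂ hab y = x.2 :=
    ⟨D.map ((Γ₁ hab).prod (Γ₂ hab)), fun x => by
      simp only [Submodule.mem_map, LinearMap.prod_apply, Function.prod, Prod.ext_iff]⟩
  have hannih : ∀ z, z ∈ D ↔ ∀ x ∈ Θ, inner ℂ x.1 (Γ₂ hab z) - inner ℂ x.2 (Γ₁ hab z) = 0 := by
    intro z
    rw [hD]
    constructor
    · intro h x hx
      obtain ⟨y, hy, e₁, e₂⟩ := (hΘ x).1 hx
      rw [← e₁, ← e₂]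
      exact h y hy
    · exact fun h y hy => h (Γ₁ hab y, Γ₂ hab y) ((hΘ _).2 ⟨y, hy, rfl, rfl⟩)
  have hmem : ∀ z, z ∈ D ↔ (Γ₁ hab z, Γ₂ hab z) ∈ Θ := by
    refine fun z => ⟨fun hz => (hΘ _).2 ⟨z, hz, rfl, rfl⟩, fun hz => ?_⟩
    obtain ⟨y, hy, e₁, e₂⟩ := (hΘ _).1 hz
    dsimp only at e₁ e₂
    rw [hannih, ← e₁, ← e₂]
    exact (hannih y).1 hy
  obtain ⟨K, hK, hKΘ⟩ := exists_unitary_of_self_dual Θ (by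
    rintro ⟨x₁, x₂⟩
    obtain ⟨z, rfl, rfl⟩ := exists_maxDomain_of_boundary hab hp h₁ h₂ h₃ x₁ x₂
    rw [← hmem, hannih])
  refine ⟨K, hK, congrArg restrictMax ?_⟩
  ext z
  rw [hmem, hKΘ, mem_boundaryDomain_iff]

theorem LK_injective (hab : a < b)
    (hp : ∀ᵐ t ∂volume.restrict (Ioo a b), p t ≠ 0)
    (h₁ : IntegrableOn (fun t => 1 / p t) (Ioo a b) volume)
    (h₂ : IntegrableOn (fun t => Q t / p t) (Ioo a b) volume)
    (h₃ : IntegrableOn (fun t => Q t ^ 2 / p t) (Ioo a b) volume) :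
    Function.Injective (LK hab p Q) := by
  intro K K' h
  have hdom : boundaryDomain hab p Q K = boundaryDomain hab p Q K' := restrictMax_injective h
  ext1 s
  -- some function satisfies the boundary condition of `K` with `Γ₁ y + i Γ₂ y = s`
  obtain ⟨x₁, x₂, hs, hr⟩ := exists_cayley_coordinates s (K s)
  obtain ⟨y, rfl, rfl⟩ := exists_maxDomain_of_boundary hab hp h₁ h₂ h₃ x₁ x₂
  have hy : y ∈ boundaryDomain hab p Q K' := by
    rw [← hdom, mem_boundaryDomain_iff, hs, hr]
  rw [mem_boundaryDomain_iff, hs, hr] at hy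
  exact hy.symm

end Restriction

end SturmLiouville

theorem mainTheorem2 (a b : ℝ) (hab : a < b) (p Q : ℝ → ℝ)
    (hp : ∀ᵐ t ∂volume.restrict (Ioo a b), p t ≠ 0)
    (h₁ : IntegrableOn (fun t => 1 / p t) (Ioo a b) volume)
    (h₂ : IntegrableOn (fun t => Q t / p t) (Ioo a b) volume)
    (h₃ : IntegrableOn (fun t => Q t ^ 2 / p t) (Ioo a b) volume) :
    (∀ K ∈ unitary (SturmLiouville.C2 →L[ℂ] SturmLiouville.C2),
      SturmLiouville.Lmin hab p Q ≤ SturmLiouville.LK hab p Q K ∧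
        IsSelfAdjoint (SturmLiouville.LK hab p Q K)) ∧
    (∀ L : SturmLiouville.L2 a b →ₗ.[ℂ] SturmLiouville.L2 a b,
      SturmLiouville.Lmin hab p Q ≤ L → IsSelfAdjoint L →
        ∃ K ∈ unitary (SturmLiouville.C2 →L[ℂ] SturmLiouville.C2),
          L = SturmLiouville.LK hab p Q K) ∧
    BijOn (fun K : SturmLiouville.C2 →L[ℂ] SturmLiouville.C2 => SturmLiouville.LK hab p Q K)
      (unitary (SturmLiouville.C2 →L[ℂ] SturmLiouville.C2))
      {L : SturmLiouville.L2 a b →ₗ.[ℂ] SturmLiouville.L2 a b |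
        SturmLiouville.Lmin hab p Q ≤ L ∧ IsSelfAdjoint L} := by
  have hforward : ∀ K ∈ unitary (SturmLiouville.C2 →L[ℂ] SturmLiouville.C2),
      SturmLiouville.Lmin hab p Q ≤ SturmLiouville.LK hab p Q K ∧
        IsSelfAdjoint (SturmLiouville.LK hab p Q K) := fun K hK =>
    ⟨SturmLiouville.restrictMax_mono (SturmLiouville.minDomain_le_boundaryDomain hab K),
      SturmLiouville.isSelfAdjoint_LK hab hp h₁ h₂ h₃ hK⟩
  refine ⟨hforward, fun L hL hsa => SturmLiouville.exists_eq_LK hab hp h₁ h₂ h₃ hL hsa,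
    hforward, (SturmLiouville.LK_injective hab hp h₁ h₂ h₃).injOn, ?_⟩
  rintro L ⟨hL, hsa⟩
  obtain ⟨K, hK, rfl⟩ := SturmLiouville.exists_eq_LK hab hp h₁ h₂ h₃ hL hsa
  exact ⟨K, hK, rfl⟩
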